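/- Let $\Bbbk$ be a field, let $n \ge 1$ and $\ell \ge 1$ be integers, and let $m_0,\dots,m_{n-1}$ be positive integers; indices of vertices and of the $m_i$ are read modulo $n$. Let $Q$ be the $n$-cycle quiver with vertices $0,\dots,n-1$ and exactly one arrow $\alpha_i\colon i\to i+1$ for each $i$, with paths read from left to right. Let $R$ be the arrow ideal of the path algebra $\Bbbk Q$, and put $B = B_{n,\ell} = \Bbbk Q/R^\ell$. Let $e_i$ be the trivial path at $i$, let $P_i = e_iB$ (a right $B$-module), and let $\alpha_{i,j}=\alpha_i\alpha_{i+1}\cdots\alpha_{i+j-1}$ be the path of length $j$ starting at $i$ (so $\alpha_{i,0}=e_i$). Let $$A = B_{n,\ell}(m_0,\dots,m_{n-1}) = \mathrm{End}_B\Big(\bigoplus_{i=0}^{n-1} P_i^{\oplus m_i}\Big),$$ with composition as product, and write $P_i^{r}$, $0\le r\le m_i-1$, for the copies of $P_i$. For $i$ modulo $n$, $0\le j\le \ell-1$, $0\le r\le m_i-1$ and $0\le s\le m_{i+j}-1$, let $X_{i,j}^{r,s}\in A$ be the endomorphism that maps $P_{i+j}^{s}$ to $P_i^{r}$ by left multiplication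 by $\alpha_{i,j}$ and is zero on all other summands. A $\Bbbk$-linear map $\Delta\colon A\to A\otimes A$ makes $A$ *non-counital Frobenius* if it is coassociative and a map of $A$-bimodules, where $A$ acts on $A\otimes A$ by left multiplication on the first and right multiplication on the second factor. A counit of $\Delta$ is a $\Bbbk$-linear map $\varepsilon\colon A\to\Bbbk$ with $(\varepsilon\otimes\mathrm{id})\Delta=\mathrm{id}=(\mathrm{id}\otimes\varepsilon)\Delta$. The algebra $A$ is *Frobenius* if some $\Delta$ makes it non-counital Frobenius and has a counit. Then the elements $X_{i,j}^{r,s}$ form a $\Bbbk$-basis of $A$, and the following hold for the $\Bbbk$-linear map $\Delta\colon A\to A\otimes A$ given on this basis by $$\Delta(X_{i,j}^{r,s}) = \sum_{p=0}^{\ell-1-j}\ \sum_{t=0}^{m_{i+j+p}-1}\ \sum_{u=0}^{m_{i+j+p-\ell+1}-1}\Big(1-\delta_{m_{i+j+p},\,m_{i+j+p-\ell+1}}(1-\delta_{t,u})\Big)\; X_{i,j+p}^{r,t}\otimes X_{i+j+p-\ell+1,\ \ell-1-p}^{u,s}.$$ (a) $\Delta$ makes $A$ non-counital Frobenius. (b)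 $A$ is Frobenius if and only if $m_i=m_{i-\ell+1}$ for all $i$; likewise, this particular $\Delta$ has a counit if and only if $m_i=m_{i-\ell+1}$ for all $i$. In that case the counit of $\Delta$ is given by $\varepsilon(X_{i,j}^{r,s})=\delta_{j,\ell-1}\,\delta_{r,s}$. -/

import Mathlib

open scoped TensorProduct

noncomputable section

/-! ## Path algebras of quivers with finitely many vertices -/

/-- All paths of a quiver, of all lengths (including the trivial ones). -/
abbrev QuiverPath (V : Type*) [Quiver V] := Σ a b : V, Quiver.Path a b

/-- The underlying vector space of the path algebra: it has the set of all paths as basis. -/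
def PathAlgebra (k V : Type*) [Field k] [Quiver V] := QuiverPath V →₀ k

namespace PathAlgebra

variable (k : Type*) {V : Type*} [Field k] [Quiver V]

instance : AddCommGroup (PathAlgebra k V) := inferInstanceAs (AddCommGroup (QuiverPath V →₀ k))
instance : Module k (PathAlgebra k V) := inferInstanceAs (Module k (QuiverPath V →₀ k))

/-- The basis vector given by a path. -/
def ofPath (p : QuiverPath V) : PathAlgebra k V := Finsupp.single p (1 : k)

/-- The trivial path at a vertex. -/
def vertex (a : V) : PathAlgebra k V := ofPath k ⟨a, a, Quiver.Path.nil⟩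

/-- The path of length one given by an arrow. -/
def arrow {a b : V} (f : a ⟶ b) : PathAlgebra k V := ofPath k ⟨a, b, f.toPath⟩

open Classical in
/-- The product of two paths, read from left to right: first `p`, then `q`, if `p` ends where `q`
starts; zero otherwise. -/
def pathMul (p q : QuiverPath V) : PathAlgebra k V :=
  if h : q.1 = p.2.1 then ofPath k ⟨p.1, q.2.1, p.2.2.comp (q.2.2.cast h rfl)⟩ else 0

/-- The bilinear extension of the product of paths. -/
def mulHom : PathAlgebra k V →ₗ[k] PathAlgebra k V →ₗ[k] PathAlgebra k V :=
  Finsupp.lift (PathAlgebra k V →ₗ[k] PathAlgebra k V) k (QuiverPath V) fun p =>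
    Finsupp.lift (PathAlgebra k V) k (QuiverPath V) fun q => pathMul k p q

instance : Mul (PathAlgebra k V) := ⟨fun x y => mulHom k x y⟩

/-- The unit is the sum of all trivial paths. -/
instance [Fintype V] : One (PathAlgebra k V) := ⟨∑ a : V, vertex k a⟩

variable {k}

theorem mul_def (x y : PathAlgebra k V) : x * y = mulHom k x y := rfl

theorem one_def [Fintype V] : (1 : PathAlgebra k V) = ∑ a : V, vertex k a := rfl

theorem ofPath_mul_ofPath (p q : QuiverPath V) :
    ofPath k p * ofPath k q = pathMul k p q := by
  have h₁ : mulHom k (ofPath k p) =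
      Finsupp.lift (PathAlgebra k V) k (QuiverPath V) fun q => pathMul k p q :=
    (Finsupp.sum_single_index (by exact zero_smul k _)).trans (one_smul k _)
  rw [mul_def, h₁]
  exact (Finsupp.sum_single_index (by exact zero_smul k _)).trans (one_smul k _)

theorem pathMul_of_eq {a b c : V} (p : Quiver.Path a b) (q : Quiver.Path b c) :
    pathMul k ⟨a, b, p⟩ ⟨b, c, q⟩ = ofPath k ⟨a, c, p.comp q⟩ := by
  simp [pathMul]

theorem pathMul_of_ne {a b c d : V} (p : Quiver.Path a b) (q : Quiver.Path c d) (h : c ≠ b) :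
    pathMul k ⟨a, b, p⟩ ⟨c, d, q⟩ = 0 := by
  simp [pathMul, h]

theorem vertex_mul_vertex (a : V) : vertex k a * vertex k a = vertex k a := by
  rw [vertex, ofPath_mul_ofPath, pathMul_of_eq, Quiver.Path.comp_nil]

theorem hom_ext {M : Type*} [AddCommGroup M] [Module k M] {f g : PathAlgebra k V →ₗ[k] M}
    (h : ∀ p, f (ofPath k p) = g (ofPath k p)) : f = g :=
  Finsupp.lhom_ext' fun p => LinearMap.ext_ring (h p)

theorem mulHom_assoc (x y z : PathAlgebra k V) :
    mulHom k (mulHom k x y) z = mulHom k x (mulHom k y z) := by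
  have key : (mulHom k (V := V)).compr₂ (mulHom k) =
      ((LinearMap.llcomp k _ _ _).flip (mulHom k (V := V)) ∘ₗ
        LinearMap.llcomp k _ _ _) ∘ₗ mulHom k := by
    refine hom_ext fun p => hom_ext fun q => hom_ext fun r => ?_
    simp only [LinearMap.compr₂_apply, LinearMap.comp_apply, LinearMap.flip_apply,
      LinearMap.llcomp_apply, ← mul_def]
    obtain ⟨a, b, p⟩ := p
    obtain ⟨c, d, q⟩ := q
    obtain ⟨e, f, r⟩ := r
    rw [ofPath_mul_ofPath, ofPath_mul_ofPath]
    by_cases h₁ : c = b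
    · subst h₁
      rw [pathMul_of_eq]
      by_cases h₂ : e = d
      · subst h₂
        rw [pathMul_of_eq, ofPath_mul_ofPath, ofPath_mul_ofPath, pathMul_of_eq, pathMul_of_eq,
          Quiver.Path.comp_assoc]
      · rw [pathMul_of_ne _ _ h₂, ofPath_mul_ofPath, pathMul_of_ne _ _ h₂]
        simp [mul_def]
    · rw [pathMul_of_ne _ _ h₁]
      by_cases h₂ : e = d
      · subst h₂
        rw [pathMul_of_eq, ofPath_mul_ofPath, pathMul_of_ne _ _ h₁]
        simp [mul_def]
      · rw [pathMul_of_ne _ _ h₂]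
        simp [mul_def]
  exact LinearMap.congr_fun (LinearMap.congr_fun (LinearMap.congr_fun key x) y) z

theorem mulHom_one [Fintype V] (x : PathAlgebra k V) : mulHom k x 1 = x := by
  have key : (mulHom k (V := V)).flip 1 = LinearMap.id := by
    refine hom_ext fun p => ?_
    obtain ⟨a, b, p⟩ := p
    rw [LinearMap.flip_apply, one_def, map_sum, LinearMap.id_apply, Finset.sum_eq_single b]
    · rw [← mul_def, vertex, ofPath_mul_ofPath, pathMul_of_eq, Quiver.Path.comp_nil]
    · intro c _ hc
      rw [← mul_def, vertex, ofPath_mul_ofPath, pathMul_of_ne _ _ hc]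
    · simp
  exact LinearMap.congr_fun key x

theorem one_mulHom [Fintype V] (x : PathAlgebra k V) : mulHom k 1 x = x := by
  have key : mulHom k (V := V) 1 = LinearMap.id := by
    refine hom_ext fun p => ?_
    obtain ⟨a, b, p⟩ := p
    rw [one_def, map_sum, LinearMap.sum_apply, LinearMap.id_apply, Finset.sum_eq_single a]
    · rw [← mul_def, vertex, ofPath_mul_ofPath, pathMul_of_eq, Quiver.Path.nil_comp]
    · intro c _ hc
      rw [← mul_def, vertex, ofPath_mul_ofPath, pathMul_of_ne _ _ hc.symm]
    · simp
  exact LinearMap.congr_fun key x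

instance [Fintype V] : Ring (PathAlgebra k V) where
  __ := (inferInstance : AddCommGroup (PathAlgebra k V))
  mul := (· * ·)
  one := 1
  left_distrib x y z := by simp [mul_def]
  right_distrib x y z := by simp [mul_def]
  zero_mul x := by simp [mul_def]
  mul_zero x := by simp [mul_def]
  mul_assoc := mulHom_assoc
  one_mul := one_mulHom
  mul_one := mulHom_one

instance [Fintype V] : Algebra k (PathAlgebra k V) :=
  Algebra.ofModule (fun c x y => by simp [mul_def]) (fun c x y => by simp [mul_def])

/-- The arrow ideal: the two-sided ideal generated by all arrows. -/
def arrowIdeal (k V : Type*) [Field k] [Quiver V] [Fintype V] : Ideal (PathAlgebra k V) :=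
  (TwoSidedIdeal.span {x | ∃ (a b : V) (f : a ⟶ b), x = arrow k f}).asIdeal

instance [Fintype V] : (arrowIdeal k V).IsTwoSided :=
  inferInstanceAs (TwoSidedIdeal.asIdeal _).IsTwoSided

end PathAlgebra

/-! ## The bound quiver algebra of the `n`-cycle -/

/-- The `n`-cycle quiver: its vertices are the residues modulo `n`, and its arrows are exactly one
arrow `i ⟶ i + 1` for each `i`. -/
instance cycleQuiver (n : ℕ) : Quiver (ZMod n) := ⟨fun i j => PLift (j = i + 1)⟩

/-- The arrow `i ⟶ i + 1` of the `n`-cycle quiver. -/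
def cycleArrow {n : ℕ} (i : ZMod n) : i ⟶ i + 1 := PLift.up rfl

/-- The path algebra of the `n`-cycle quiver modulo the `ℓ`-th power of its arrow ideal. -/
def BoundCycle (k : Type*) [Field k] (n ℓ : ℕ) [NeZero n] :=
  PathAlgebra k (ZMod n) ⧸ PathAlgebra.arrowIdeal k (ZMod n) ^ ℓ

namespace BoundCycle

variable (k : Type*) [Field k] (n ℓ : ℕ) [NeZero n]

instance : Ring (BoundCycle k n ℓ) :=
  inferInstanceAs (Ring (PathAlgebra k (ZMod n) ⧸ PathAlgebra.arrowIdeal k (ZMod n) ^ ℓ))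

instance : Algebra k (BoundCycle k n ℓ) :=
  inferInstanceAs (Algebra k (PathAlgebra k (ZMod n) ⧸ PathAlgebra.arrowIdeal k (ZMod n) ^ ℓ))

/-- The quotient map from the path algebra. -/
def mk : PathAlgebra k (ZMod n) →ₐ[k] BoundCycle k n ℓ := Ideal.Quotient.mkₐ k _

variable {n}

/-- The class of the trivial path at the vertex `i`. -/
def e (i : ZMod n) : BoundCycle k n ℓ :=
  mk k n ℓ (PathAlgebra.vertex k i)

/-- The class of the arrow `i ⟶ i + 1`. -/
def arr (i : ZMod n) : BoundCycle k n ℓ :=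
  mk k n ℓ (PathAlgebra.arrow k (cycleArrow i))

/-- The class `α_{i,j}` of the path of length `j` starting at the vertex `i`; in particular
`α_{i,0} = e_i`. -/
def path (i : ZMod n) : ℕ → BoundCycle k n ℓ
  | 0 => e k ℓ i
  | j + 1 => path i j * arr k ℓ (i + (j : ZMod n))

theorem e_mul_path (i : ZMod n) (j : ℕ) : e k ℓ i * path k ℓ i j = path k ℓ i j := by
  induction j with
  | zero =>
    change e k ℓ i * e k ℓ i = e k ℓ i
    rw [e, ← map_mul, PathAlgebra.vertex_mul_vertex]
  | succ j ih => rw [path, ← mul_assoc, ih]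

/-- The right module `P_i = e_i B`, as a submodule of `B` over the opposite ring of `B`. -/
def P (i : ZMod n) : Submodule (BoundCycle k n ℓ)ᵐᵒᵖ (BoundCycle k n ℓ) :=
  Submodule.span (BoundCycle k n ℓ)ᵐᵒᵖ {e k ℓ i}

theorem mem_P_iff (i : ZMod n) (x : BoundCycle k n ℓ) : x ∈ P k ℓ i ↔ ∃ b, x = e k ℓ i * b := by
  rw [P, Submodule.mem_span_singleton]
  constructor
  · rintro ⟨b, rfl⟩
    exact ⟨b.unop, rfl⟩
  · rintro ⟨b, rfl⟩
    exact ⟨MulOpposite.op b, rfl⟩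

/-- Left multiplication by `α_{i,j}`, as a map of right modules `P_{i+j} → P_i`. -/
def precomp (i : ZMod n) (j : ℕ) : P k ℓ (i + (j : ZMod n)) →ₗ[(BoundCycle k n ℓ)ᵐᵒᵖ] P k ℓ i where
  toFun v := ⟨path k ℓ i j * v, by
    rw [mem_P_iff]
    exact ⟨path k ℓ i j * v, by rw [← mul_assoc, e_mul_path]⟩⟩
  map_add' v w := by
    ext
    simp [mul_add]
  map_smul' b v := by
    ext
    simp [mul_assoc]

end BoundCycle

/-! ## The algebras `B_{n,ℓ}(m_0, …, m_{n-1})` -/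

/-- The right module `⨁ i, P_i ^ (m i)`: one summand for each pair of a vertex `i` and a number
`r < m i`. -/
abbrev NSYModule (k : Type*) [Field k] {n : ℕ} [NeZero n] (ℓ : ℕ) (m : ZMod n → ℕ) :=
  (x : Σ i : ZMod n, Fin (m i)) → BoundCycle.P k ℓ x.1

/-- The endomorphism algebra of the right module `⨁ i, P_i ^ (m i)`, with composition as product. -/
def NSYAlgebra (k : Type*) [Field k] {n : ℕ} [NeZero n] (ℓ : ℕ) (m : ZMod n → ℕ) :=
  Module.End (BoundCycle k n ℓ)ᵐᵒᵖ (NSYModule k ℓ m)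

instance (k : Type*) [Field k] {n : ℕ} [NeZero n] (ℓ : ℕ) (m : ZMod n → ℕ) :
    Ring (NSYAlgebra k ℓ m) :=
  inferInstanceAs (Ring (Module.End (BoundCycle k n ℓ)ᵐᵒᵖ (NSYModule k ℓ m)))

instance (k : Type*) [Field k] {n : ℕ} [NeZero n] (ℓ : ℕ) (m : ZMod n → ℕ) :
    Algebra k (NSYAlgebra k ℓ m) :=
  inferInstanceAs (Algebra k (Module.End (BoundCycle k n ℓ)ᵐᵒᵖ (NSYModule k ℓ m)))

/-- The elements of the algebra, seen as endomorphisms. -/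
def NSYAlgebra.toEnd (k : Type*) [Field k] {n : ℕ} [NeZero n] (ℓ : ℕ) (m : ZMod n → ℕ) :
    NSYAlgebra k ℓ m ≃ₐ[k] Module.End (BoundCycle k n ℓ)ᵐᵒᵖ (NSYModule k ℓ m) :=
  AlgEquiv.refl

/-- The endomorphism `X_{i,j}^{r,s}`, which maps the copy of `P_{i+j}` with number `s` to the copy of
`P_i` with number `r` by left multiplication by `α_{i,j}`, and is zero on all other summands. It is
used only for `r < m i` and `s < m (i + j)`, and set to zero otherwise. -/
def nsyX (k : Type*) [Field k] {n : ℕ} [NeZero n] (ℓ : ℕ) (m : ZMod n → ℕ)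
    (i : ZMod n) (j r s : ℕ) : NSYAlgebra k ℓ m :=
  if h : r < m i ∧ s < m (i + j) then
    (NSYAlgebra.toEnd k ℓ m).symm
      (LinearMap.single (BoundCycle k n ℓ)ᵐᵒᵖ
          (fun x : Σ i : ZMod n, Fin (m i) => BoundCycle.P k ℓ x.1) ⟨i, ⟨r, h.1⟩⟩ ∘ₗ
        BoundCycle.precomp k ℓ i j ∘ₗ
        LinearMap.proj (φ := fun x : Σ i : ZMod n, Fin (m i) => BoundCycle.P k ℓ x.1)
          ⟨i + j, ⟨s, h.2⟩⟩)
  else 0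

/-- The admissible indices `(i, j, r, s)`: `0 ≤ j < ℓ`, `0 ≤ r < m i` and `0 ≤ s < m (i + j)`. -/
abbrev NSYIndex {n : ℕ} (ℓ : ℕ) (m : ZMod n → ℕ) :=
  {x : ZMod n × ℕ × ℕ × ℕ //
    x.2.1 < ℓ ∧ x.2.2.1 < m x.1 ∧ x.2.2.2 < m (x.1 + (x.2.1 : ZMod n))}

/-! ## Frobenius structures -/

/-- `Δ` is a coassociative map of `A`-bimodules, where `A` acts on `A ⊗ A` from the left on the first
and from the right on the second factor. -/
structure IsNonCounitalFrobenius {k A : Type*} [Field k] [Ring A] [Algebra k A]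
    (Δ : A →ₗ[k] A ⊗[k] A) : Prop where
  coassoc : (TensorProduct.assoc k A A A).toLinearMap ∘ₗ Δ.rTensor A ∘ₗ Δ = Δ.lTensor A ∘ₗ Δ
  map_mul_left : ∀ a x : A, Δ (a * x) = (LinearMap.mulLeft k a).rTensor A (Δ x)
  map_mul_right : ∀ x a : A, Δ (x * a) = (LinearMap.mulRight k a).lTensor A (Δ x)

/-- `ε` is a counit of `Δ`. -/
structure IsCounitOf {k A : Type*} [Field k] [Ring A] [Algebra k A]
    (Δ : A →ₗ[k] A ⊗[k] A) (ε : A →ₗ[k] k) : Prop where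
  left : (TensorProduct.lid k A).toLinearMap ∘ₗ ε.rTensor A ∘ₗ Δ = LinearMap.id
  right : (TensorProduct.rid k A).toLinearMap ∘ₗ ε.lTensor A ∘ₗ Δ = LinearMap.id

/-- `A` is a Frobenius algebra: it admits a coassociative and counital comultiplication which is a map
of `A`-bimodules. -/
def IsFrobeniusAlgebra (k A : Type*) [Field k] [Ring A] [Algebra k A] : Prop :=
  ∃ (Δ : A →ₗ[k] A ⊗[k] A) (ε : A →ₗ[k] k), IsNonCounitalFrobenius Δ ∧ IsCounitOf Δ ε

end

open scoped TensorProduct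

noncomputable section

/-! ## Comultiplications from Casimir elements -/

/-! A bimodule map Δ is determined by t = Δ(1), and conversely an element t of A ⊗ A with a·t = t·a
for all a yields Δ(a) = a·t, whose coassociativity is automatic. Here t = `casimir` is the weighted
sum of the tensors X_{i,p}^{r,t} ⊗ X_{i+p-ℓ+1, ℓ-1-p}^{u,r}: the second path ends where the first
begins, and together they have length ℓ-1. Multiplying by X_{i,j}^{r,s} on either side gives the
stated formula, because paths of length at least ℓ vanish (`leftActionOn_casimir`,
`rightActionOn_casimir`).

If m_i = m_{i-ℓ+1} for all i, the weight is δ_{t,u}, and applying ε to either factor of t returns 1,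
which is all a counit needs.

Conversely, for any Frobenius structure the form (x, y) ↦ ε(xy) is nondegenerate. The span of the
X_{i,ℓ-1}^{0,s} has dimension m_{i+ℓ-1} and is killed from the left by every basis element except
the m_i elements X_{i,0}^{r,0}, so m_{i+ℓ-1} ≤ m_i (`multiplicity_le`). Summing around the cycle
forces equality.

The basis rests on two facts: A acts by matrices over B whose entries lie in e_i B e_h
(`toEnd_apply`), and the paths of length below ℓ form a basis of B (`coeff_path`, `eq_sum_coeff`).
-/

section Casimir

variable {k A : Type*} [Field k] [Ring A] [Algebra k A]

/-- The map `a ↦ a • t`, where `A` acts on the first factor of `A ⊗ A` from the left. -/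
def leftActionOn (t : A ⊗[k] A) : A →ₗ[k] A ⊗[k] A :=
  (LinearMap.rTensorHom A).flip t ∘ₗ LinearMap.mul k A

theorem leftActionOn_apply (t : A ⊗[k] A) (a : A) :
    leftActionOn t a = (LinearMap.mulLeft k a).rTensor A t := rfl

/-- The map `a ↦ t • a`, where `A` acts on the second factor of `A ⊗ A` from the right. -/
def rightActionOn (t : A ⊗[k] A) : A →ₗ[k] A ⊗[k] A :=
  (LinearMap.lTensorHom A).flip t ∘ₗ (LinearMap.mul k A).flip

theorem rightActionOn_apply (t : A ⊗[k] A) (a : A) :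
    rightActionOn t a = (LinearMap.mulRight k a).lTensor A t := rfl

theorem leftActionOn_add (s t : A ⊗[k] A) :
    leftActionOn (s + t) = leftActionOn s + leftActionOn t := by
  ext a
  simp [leftActionOn_apply]

theorem rightActionOn_add (s t : A ⊗[k] A) :
    rightActionOn (s + t) = rightActionOn s + rightActionOn t := by
  ext a
  simp [rightActionOn_apply]

theorem leftActionOn_zero : leftActionOn (0 : A ⊗[k] A) = 0 := by
  ext a
  simp [leftActionOn_apply]

theorem rightActionOn_zero : rightActionOn (0 : A ⊗[k] A) = 0 := by
  ext a
  simp [rightActionOn_apply]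

/-- By bilinearity take s = x ⊗ y and t = z ⊗ w; both sides are then x ⊗ yaz ⊗ w. With s = t and
equal actions this is coassociativity. -/
theorem assoc_rTensor_rightActionOn (s t : A ⊗[k] A) (a : A) :
    TensorProduct.assoc k A A A ((rightActionOn s).rTensor A (leftActionOn t a)) =
      (leftActionOn t).lTensor A (rightActionOn s a) := by
  induction s with
  | zero => simp [rightActionOn_zero]
  | add s₁ s₂ h₁ h₂ =>
    simp only [rightActionOn_add, LinearMap.rTensor_add, LinearMap.add_apply, map_add, h₁, h₂]
  | tmul x y =>
    induction t with
    | zero => simp [leftActionOn_zero]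
    | add t₁ t₂ h₁ h₂ =>
      simp only [leftActionOn_add, LinearMap.lTensor_add, LinearMap.add_apply, map_add, h₁, h₂]
    | tmul z w => simp [leftActionOn_apply, rightActionOn_apply, mul_assoc]

/-- A Casimir element gives a non-counital Frobenius structure. -/
theorem isNonCounitalFrobenius_leftActionOn (t : A ⊗[k] A)
    (h : leftActionOn t = rightActionOn t) : IsNonCounitalFrobenius (leftActionOn t) where
  coassoc := by
    ext a
    simp only [LinearMap.comp_apply, LinearEquiv.coe_coe]
    -- Only the outer copy of Δ, the one applied to the first factor, is turned into the right
    -- action.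
    conv_lhs => arg 2; arg 1; rw [h]
    rw [assoc_rTensor_rightActionOn, ← h]
  map_mul_left a x := by
    simp only [leftActionOn_apply, LinearMap.mulLeft_mul, LinearMap.rTensor_comp,
      LinearMap.comp_apply]
  map_mul_right x a := by
    have hx : leftActionOn t (x * a) = (LinearMap.mulLeft k x).rTensor A (leftActionOn t a) := by
      simp only [leftActionOn_apply, LinearMap.mulLeft_mul, LinearMap.rTensor_comp,
        LinearMap.comp_apply]
    -- Left multiplication on the first factor commutes with right multiplication on the second.
    rw [hx, h, rightActionOn_apply, ← h, leftActionOn_apply, ← LinearMap.comp_apply,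
      ← LinearMap.comp_apply, LinearMap.lTensor_comp_rTensor, LinearMap.rTensor_comp_lTensor]

/-- Evaluating ε on the first factor commutes with the right action on the second, so the counit law
only has to be checked at 1. The Casimir property converts Δ to that right action; the mirror law
below does not need it. -/
theorem counit_left_leftActionOn (t : A ⊗[k] A) (h : leftActionOn t = rightActionOn t)
    (ε : A →ₗ[k] k) (hε : TensorProduct.lid k A (ε.rTensor A t) = 1) :
    (TensorProduct.lid k A).toLinearMap ∘ₗ ε.rTensor A ∘ₗ leftActionOn t = LinearMap.id := by
  have key (s : A ⊗[k] A) (a : A) : TensorProduct.lid k A (ε.rTensor A (rightActionOn s a)) =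
      TensorProduct.lid k A (ε.rTensor A s) * a := by
    induction s with
    | zero => simp [rightActionOn_zero]
    | add s₁ s₂ h₁ h₂ => simp only [rightActionOn_add, LinearMap.add_apply, map_add, h₁, h₂, add_mul]
    | tmul x y => simp [rightActionOn_apply]
  ext a
  simp [h, key, hε]

theorem counit_right_leftActionOn (t : A ⊗[k] A)
    (ε : A →ₗ[k] k) (hε : TensorProduct.rid k A (ε.lTensor A t) = 1) :
    (TensorProduct.rid k A).toLinearMap ∘ₗ ε.lTensor A ∘ₗ leftActionOn t = LinearMap.id := by
  have key (s : A ⊗[k] A) (a : A) : TensorProduct.rid k A (ε.lTensor A (leftActionOn s a)) =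
      a * TensorProduct.rid k A (ε.lTensor A s) := by
    induction s with
    | zero => simp [leftActionOn_zero]
    | add s₁ s₂ h₁ h₂ => simp only [leftActionOn_add, LinearMap.add_apply, map_add, h₁, h₂, mul_add]
    | tmul x y => simp [leftActionOn_apply]
  ext a
  simp [key, hε]

/-- The form `(x, y) ↦ ε (x * y)` of a Frobenius algebra is nondegenerate. -/
theorem IsNonCounitalFrobenius.eq_zero_of_forall_counit_mul {Δ : A →ₗ[k] A ⊗[k] A} {ε : A →ₗ[k] k}
    (hΔ : IsNonCounitalFrobenius Δ) (hε : IsCounitOf Δ ε) {v : A} (hv : ∀ y, ε (y * v) = 0) :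
    v = 0 := by
  have h := LinearMap.congr_fun hε.right v
  have hz : ε ∘ₗ LinearMap.mulRight k v = 0 := LinearMap.ext hv
  -- Here v = (id ⊗ ε)Δ(v) and Δ(v) = Δ(1)·v, so ε only meets elements of the form yv.
  rw [LinearMap.comp_apply, LinearMap.comp_apply, ← one_mul v, hΔ.map_mul_right 1 v,
    ← LinearMap.comp_apply (LinearMap.lTensor A ε), ← LinearMap.lTensor_comp, hz] at h
  simpa using h.symm

end Casimir

/-! ## The length filtration of a path algebra -/

namespace PathAlgebra

variable {k V : Type*} [Field k] [Quiver V]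

/-- The span of the paths of length at least `d`. -/
def lengthGE (k V : Type*) [Field k] [Quiver V] (d : ℕ) : Submodule k (PathAlgebra k V) :=
  Submodule.span k (ofPath k '' {p | d ≤ p.2.2.length})

theorem ofPath_mem_lengthGE {p : QuiverPath V} {d : ℕ} (h : d ≤ p.2.2.length) :
    ofPath k p ∈ lengthGE k V d :=
  Submodule.subset_span ⟨p, h, rfl⟩

theorem mul_mem_lengthGE [Fintype V] {c d : ℕ} {x y : PathAlgebra k V} (hx : x ∈ lengthGE k V c)
    (hy : y ∈ lengthGE k V d) : x * y ∈ lengthGE k V (c + d) := by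
  induction hx using Submodule.span_induction with
  | zero => simp
  | add x₁ x₂ _ _ h₁ h₂ => rw [add_mul]; exact add_mem h₁ h₂
  | smul a x _ h => rw [smul_mul_assoc]; exact Submodule.smul_mem _ a h
  | mem x hx =>
    obtain ⟨p, hp, rfl⟩ := hx
    induction hy using Submodule.span_induction with
    | zero => simp
    | add x₁ x₂ _ _ h₁ h₂ => rw [mul_add]; exact add_mem h₁ h₂
    | smul a x _ h => rw [mul_smul_comm]; exact Submodule.smul_mem _ a h
    | mem y hy =>
      obtain ⟨q, hq, rfl⟩ := hy
      obtain ⟨a, b, p⟩ := p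
      obtain ⟨c', d', q⟩ := q
      rw [ofPath_mul_ofPath]
      by_cases h : c' = b
      · subst h
        rw [pathMul_of_eq]
        refine ofPath_mem_lengthGE ?_
        simp only [Set.mem_ofPred_eq] at hp hq
        simp only [Quiver.Path.length_comp]
        omega
      · rw [pathMul_of_ne _ _ h]
        exact zero_mem _

theorem mem_lengthGE_zero (x : PathAlgebra k V) : x ∈ lengthGE k V 0 := by
  have h : (lengthGE k V 0).mkQ = 0 := by
    refine hom_ext fun p => ?_
    rw [LinearMap.zero_apply, Submodule.mkQ_apply, Submodule.Quotient.mk_eq_zero]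
    exact ofPath_mem_lengthGE (Nat.zero_le _)
  rw [← Submodule.Quotient.mk_eq_zero, ← Submodule.mkQ_apply, h, LinearMap.zero_apply]

theorem arrowIdeal_le_lengthGE [Fintype V] {x : PathAlgebra k V} (hx : x ∈ arrowIdeal k V) :
    x ∈ lengthGE k V 1 := by
  rw [arrowIdeal, TwoSidedIdeal.mem_asIdeal] at hx
  -- The span of the paths of positive length is itself a two-sided ideal containing the arrows.
  have hle : TwoSidedIdeal.span {x | ∃ (a b : V) (f : a ⟶ b), x = arrow k f} ≤
      TwoSidedIdeal.mk' (lengthGE k V 1 : Set (PathAlgebra k V)) (zero_mem _)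
        (fun hx hy => add_mem hx hy) (fun hx => neg_mem hx)
        (fun {x y} hy => by simpa using mul_mem_lengthGE (mem_lengthGE_zero x) hy)
        (fun {x y} hx => by simpa using mul_mem_lengthGE hx (mem_lengthGE_zero y)) := by
    rw [TwoSidedIdeal.span_le]
    rintro _ ⟨a, b, f, rfl⟩
    rw [SetLike.mem_coe, TwoSidedIdeal.mem_mk']
    exact ofPath_mem_lengthGE le_rfl
  simpa using hle hx

theorem arrowIdeal_pow_le_lengthGE [Fintype V] (d : ℕ) :
    ∀ x ∈ arrowIdeal k V ^ d, x ∈ lengthGE k V d := by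
  induction d with
  | zero => exact fun x _ => mem_lengthGE_zero x
  | succ d ih =>
    intro x hx
    rw [Submodule.pow_succ] at hx
    refine Submodule.mul_induction_on hx ?_ fun _ _ h₁ h₂ => add_mem h₁ h₂
    exact fun y hy z hz => mul_mem_lengthGE (ih y hy) (arrowIdeal_le_lengthGE hz)

theorem ofPath_cons {a b c : V} (p : Quiver.Path a b) (f : b ⟶ c) :
    ofPath k ⟨a, c, p.cons f⟩ = ofPath k ⟨a, b, p⟩ * arrow k f := by
  rw [arrow, ofPath_mul_ofPath, pathMul_of_eq]
  rfl

theorem arrow_mem_arrowIdeal [Fintype V] {a b : V} (f : a ⟶ b) :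
    arrow k f ∈ arrowIdeal k V := by
  rw [arrowIdeal, TwoSidedIdeal.mem_asIdeal]
  exact TwoSidedIdeal.subset_span ⟨a, b, f, rfl⟩

theorem ofPath_mem_arrowIdeal_pow [Fintype V] {a b : V} (p : Quiver.Path a b) :
    ofPath k ⟨a, b, p⟩ ∈ arrowIdeal k V ^ p.length := by
  induction p with
  | nil => rw [Quiver.Path.length_nil, Submodule.pow_zero, Ideal.one_eq_top]; trivial
  | cons p f ih =>
    rw [ofPath_cons, Quiver.Path.length_cons, Submodule.pow_succ]
    exact Ideal.mul_mem_mul ih (arrow_mem_arrowIdeal f)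

open Classical in
/-- The sum of the coefficients of the paths of length `j` that start at `i`. -/
def coeffSum (k : Type*) {V : Type*} [Field k] [Quiver V] (i : V) (j : ℕ) :
    PathAlgebra k V →ₗ[k] k :=
  Finsupp.lift k k (QuiverPath V) fun p => if p.1 = i ∧ p.2.2.length = j then 1 else 0

open Classical in
theorem coeffSum_ofPath (i : V) (j : ℕ) (p : QuiverPath V) :
    coeffSum k i j (ofPath k p) = if p.1 = i ∧ p.2.2.length = j then 1 else 0 :=
  (Finsupp.sum_single_index (by exact zero_smul k _)).trans (one_smul k _)

theorem coeffSum_eq_zero {i : V} {j d : ℕ} (hj : j < d) {x : PathAlgebra k V}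
    (hx : x ∈ lengthGE k V d) : coeffSum k i j x = 0 := by
  induction hx using Submodule.span_induction with
  | zero => simp
  | add x₁ x₂ _ _ h₁ h₂ => rw [map_add, h₁, h₂, add_zero]
  | smul a x _ h => rw [map_smul, h, smul_zero]
  | mem x hx =>
    obtain ⟨p, hp, rfl⟩ := hx
    rw [coeffSum_ofPath, if_neg]
    rintro ⟨_, h⟩
    simp only [Set.mem_ofPred_eq] at hp
    omega

end PathAlgebra

/-! ## The basis of the bound quiver algebra of the cycle -/

namespace BoundCycle

theorem cycle_path_target {n : ℕ} {a b : ZMod n} (p : Quiver.Path a b) : b = a + p.length := by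
  induction p with
  | nil => simp
  | cons p f ih =>
    rw [Quiver.Path.length_cons, Nat.cast_succ, ← add_assoc, ← ih]
    exact f.down

/-- The path of length `j` that starts at `i`. -/
def cyclePath {n : ℕ} (i : ZMod n) : (j : ℕ) → Quiver.Path i (i + (j : ZMod n))
  | 0 => Quiver.Path.nil.cast rfl (by simp)
  | j + 1 => ((cyclePath i j).cons (cycleArrow _)).cast rfl (by push_cast; ring)

theorem length_cast {V : Type*} [Quiver V] {a b c d : V} (h : a = c) (h' : b = d)
    (p : Quiver.Path a b) : (p.cast h h').length = p.length := by
  subst h h'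
  rfl

theorem length_cyclePath {n : ℕ} (i : ZMod n) (j : ℕ) : (cyclePath i j).length = j := by
  induction j with
  | zero => simp [cyclePath, length_cast]
  | succ j ih => simp [cyclePath, length_cast, ih]

variable (k : Type*) [Field k] {n : ℕ} (ℓ : ℕ) [NeZero n]

theorem mk_surjective : Function.Surjective (mk k n ℓ) := Ideal.Quotient.mk_surjective

theorem mk_eq_zero_iff (x : PathAlgebra k (ZMod n)) :
    mk k n ℓ x = 0 ↔ x ∈ PathAlgebra.arrowIdeal k (ZMod n) ^ ℓ :=
  Ideal.Quotient.eq_zero_iff_mem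

/-- A single arrow leaves each vertex of the cycle, so a path is determined by its start and length.
-/
theorem mk_ofPath {a b : ZMod n} (p : Quiver.Path a b) :
    mk k n ℓ (PathAlgebra.ofPath k ⟨a, b, p⟩) = path k ℓ a p.length := by
  induction p with
  | nil => rfl
  | @cons b c p f ih =>
    obtain ⟨rfl⟩ := f
    rw [PathAlgebra.ofPath_cons, map_mul, ih, Quiver.Path.length_cons, path,
      ← cycle_path_target p]
    rfl

theorem path_eq_mk (i : ZMod n) (j : ℕ) :
    path k ℓ i j = mk k n ℓ (PathAlgebra.ofPath k ⟨i, _, cyclePath i j⟩) := by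
  rw [mk_ofPath, length_cyclePath]

theorem path_eq_zero {i : ZMod n} {j : ℕ} (h : ℓ ≤ j) : path k ℓ i j = 0 := by
  rw [path_eq_mk, mk_eq_zero_iff]
  refine Ideal.pow_le_pow_right h ?_
  convert PathAlgebra.ofPath_mem_arrowIdeal_pow (cyclePath i j)
  rw [length_cyclePath]

theorem e_mul_e (i h : ZMod n) : e k ℓ i * e k ℓ h = if h = i then e k ℓ i else 0 := by
  split_ifs with hi
  · subst hi
    rw [e, ← map_mul, PathAlgebra.vertex_mul_vertex]
  · rw [e, e, ← map_mul, PathAlgebra.vertex, PathAlgebra.vertex, PathAlgebra.ofPath_mul_ofPath,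
      PathAlgebra.pathMul_of_ne _ _ hi, map_zero]

theorem path_mul_path (i h : ZMod n) (j q : ℕ) :
    path k ℓ i j * path k ℓ h q = if h = i + j then path k ℓ i (j + q) else 0 := by
  split_ifs with hi
  · subst hi
    induction q with
    | zero =>
      rw [path_eq_mk, path_eq_mk, ← map_mul, PathAlgebra.ofPath_mul_ofPath,
        PathAlgebra.pathMul_of_eq, mk_ofPath]
      simp [length_cyclePath]
    | succ q ih =>
      rw [path, ← mul_assoc, ih, ← Nat.add_assoc, path, Nat.cast_add, add_assoc]
  · rw [path_eq_mk, path_eq_mk, ← map_mul, PathAlgebra.ofPath_mul_ofPath,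
      PathAlgebra.pathMul_of_ne _ _ hi, map_zero]

theorem path_mul_e (i h : ZMod n) (j : ℕ) :
    path k ℓ i j * e k ℓ h = if h = i + j then path k ℓ i j else 0 :=
  path_mul_path k ℓ i h j 0

theorem e_mul_path_eq (i h : ZMod n) (q : ℕ) :
    e k ℓ i * path k ℓ h q = if h = i then path k ℓ i q else 0 := by
  have := path_mul_path k ℓ i h 0 q
  rwa [Nat.cast_zero, add_zero, Nat.zero_add] at this

/-- R^ℓ lies in the span of paths of length at least ℓ > j, where `coeffSum` vanishes, so the
functional descends to the quotient; it is built from a linear section of `mk`. -/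
theorem exists_coeff (i : ZMod n) {j : ℕ} (hj : j < ℓ) : ∃ c : BoundCycle k n ℓ →ₗ[k] k,
    ∀ x, c (mk k n ℓ x) = PathAlgebra.coeffSum k i j x := by
  obtain ⟨s, hs⟩ := (mk k n ℓ).toLinearMap.exists_rightInverse_of_surjective
    (LinearMap.range_eq_top.2 (mk_surjective k ℓ))
  refine ⟨PathAlgebra.coeffSum k i j ∘ₗ s, fun x => ?_⟩
  rw [← sub_eq_zero, LinearMap.comp_apply, ← map_sub]
  refine PathAlgebra.coeffSum_eq_zero hj (PathAlgebra.arrowIdeal_pow_le_lengthGE ℓ _ ?_)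
  rw [← mk_eq_zero_iff, map_sub, sub_eq_zero]
  exact LinearMap.congr_fun hs _

/-- The coefficient of the path of length `j` that starts at `i`, for `j < ℓ`. -/
def coeff (i : ZMod n) (j : Fin ℓ) : BoundCycle k n ℓ →ₗ[k] k :=
  (exists_coeff k ℓ i j.2).choose

theorem coeff_mk (i : ZMod n) (j : Fin ℓ) (x : PathAlgebra k (ZMod n)) :
    coeff k ℓ i j (mk k n ℓ x) = PathAlgebra.coeffSum k i j x :=
  (exists_coeff k ℓ i j.2).choose_spec x

theorem coeff_path (i h : ZMod n) (j : Fin ℓ) (q : ℕ) :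
    coeff k ℓ i j (path k ℓ h q) = if h = i ∧ q = j then 1 else 0 := by
  classical
  rw [path_eq_mk, coeff_mk, PathAlgebra.coeffSum_ofPath]
  simp [length_cyclePath]

theorem eq_sum_coeff (x : BoundCycle k n ℓ) :
    x = ∑ i, ∑ j, coeff k ℓ i j x • path k ℓ i j := by
  obtain ⟨x, rfl⟩ := mk_surjective k ℓ x
  have h : (mk k n ℓ).toLinearMap =
      (∑ i, ∑ j, (coeff k ℓ i j).smulRight (path k ℓ i j)) ∘ₗ (mk k n ℓ).toLinearMap := by
    refine PathAlgebra.hom_ext fun p => ?_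
    obtain ⟨a, b, p⟩ := p
    simp only [LinearMap.comp_apply, AlgHom.toLinearMap_apply, mk_ofPath, LinearMap.sum_apply,
      LinearMap.smulRight_apply, coeff_path]
    rw [Finset.sum_eq_single a (by intro i _ hi; simp [hi.symm]) (by simp)]
    by_cases hp : p.length < ℓ
    · rw [Finset.sum_eq_single ⟨p.length, hp⟩ _ (by simp)]
      · simp
      · intro j _ hj
        rw [if_neg, zero_smul]
        rintro ⟨_, h⟩
        exact hj (Fin.ext h.symm)
    -- Paths too long to have a coefficient are already zero in the quotient.
    · rw [path_eq_zero k ℓ (not_lt.1 hp), Finset.sum_eq_zero]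
      intro j _
      rw [if_neg, zero_smul]
      rintro ⟨_, h⟩
      exact hp (h ▸ j.2)
  simpa using LinearMap.congr_fun h x

/-- An element of `e_i B e_h` is a combination of the paths from `i` to `h`. -/
theorem eq_sum_coeff_of_mul {i h : ZMod n} {x : BoundCycle k n ℓ} (hi : e k ℓ i * x = x)
    (hh : x * e k ℓ h = x) :
    x = ∑ j : Fin ℓ, if h = i + (j : ℕ) then coeff k ℓ i j x • path k ℓ i j else 0 := by
  conv_lhs => rw [← hh, ← hi, eq_sum_coeff k ℓ x]
  simp only [Finset.mul_sum, Finset.sum_mul, mul_smul_comm, smul_mul_assoc, e_mul_path_eq]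
  rw [Finset.sum_eq_single i (by intro i' _ hi; simp [hi]) (by simp)]
  refine Finset.sum_congr rfl fun j _ => ?_
  rw [if_pos rfl, path_mul_e]
  split_ifs <;> simp

end BoundCycle

/-! ## Matrix entries of the elements of the endomorphism algebra -/

namespace NSYAlgebra

open BoundCycle

variable (k : Type*) [Field k] {n : ℕ} [NeZero n] (ℓ : ℕ) (m : ZMod n → ℕ)

/-- The generator `e_i` of `P_i`. -/
def gen (i : ZMod n) : P k ℓ i := ⟨e k ℓ i, Submodule.mem_span_singleton_self _⟩

variable {k ℓ} in
theorem e_mul_coe {i : ZMod n} (v : P k ℓ i) : e k ℓ i * (v : BoundCycle k n ℓ) = v := by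
  obtain ⟨v, hv⟩ := v
  obtain ⟨b, rfl⟩ := (mem_P_iff k ℓ i v).1 hv
  simp only [← mul_assoc, e_mul_e, if_pos]

/-- The entry at `(x, y)` of an endomorphism of `⨁ i, P_i ^ (m i)`: the component at `x` of the image
of the generator of the summand at `y`. -/
def entry (x y : Σ i : ZMod n, Fin (m i)) : NSYAlgebra k ℓ m →ₗ[k] BoundCycle k n ℓ where
  toFun f := (toEnd k ℓ m f (Pi.single y (gen k ℓ y.1)) x : P k ℓ x.1)
  map_add' f g := by simp
  map_smul' c f := by simp

theorem entry_apply (x y : Σ i : ZMod n, Fin (m i)) (f : NSYAlgebra k ℓ m) :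
    entry k ℓ m x y f = (toEnd k ℓ m f (Pi.single y (gen k ℓ y.1)) x : P k ℓ x.1) := rfl

/-- The vector v is the sum of the generators times its coordinates, and f is right B-linear; hence
f acts as a matrix over B. -/
theorem toEnd_apply (f : NSYAlgebra k ℓ m) (v : NSYModule k ℓ m) (x : Σ i : ZMod n, Fin (m i)) :
    (toEnd k ℓ m f v x : BoundCycle k n ℓ) = ∑ y, entry k ℓ m x y f * v y := by
  have hv : v = ∑ y, MulOpposite.op (v y : BoundCycle k n ℓ) •
      (Pi.single y (gen k ℓ y.1) : NSYModule k ℓ m) := by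
    conv_lhs => rw [← Finset.univ_sum_single v]
    refine Finset.sum_congr rfl fun y _ => ?_
    rw [← Pi.single_smul]
    congr 1
    ext
    exact (e_mul_coe (v y)).symm
  conv_lhs => rw [hv]
  simp [map_sum, entry_apply]

theorem ext_entry {f g : NSYAlgebra k ℓ m} (h : ∀ x y, entry k ℓ m x y f = entry k ℓ m x y g) :
    f = g := by
  apply (toEnd k ℓ m).injective
  refine LinearMap.ext fun v => funext fun x => Subtype.ext ?_
  rw [toEnd_apply, toEnd_apply]
  simp only [h]

/-- With `entry_mul_e` this puts each entry in some e_i B e_h, where `eq_sum_coeff_of_mul` applies.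
-/
theorem e_mul_entry (f : NSYAlgebra k ℓ m) (x y : Σ i : ZMod n, Fin (m i)) :
    e k ℓ x.1 * entry k ℓ m x y f = entry k ℓ m x y f :=
  e_mul_coe _

theorem entry_mul_e (f : NSYAlgebra k ℓ m) (x y : Σ i : ZMod n, Fin (m i)) :
    entry k ℓ m x y f * e k ℓ y.1 = entry k ℓ m x y f := by
  conv_rhs => rw [entry_apply, toEnd_apply]
  rw [Finset.sum_eq_single y _ (by simp)]
  · simp [gen]
  · intro z _ hz
    simp [Pi.single_eq_of_ne hz]

theorem entry_mul (f g : NSYAlgebra k ℓ m) (x y : Σ i : ZMod n, Fin (m i)) :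
    entry k ℓ m x y (f * g) = ∑ z, entry k ℓ m x z f * entry k ℓ m z y g := by
  rw [entry_apply, map_mul, Module.End.mul_apply, toEnd_apply]
  rfl

theorem entry_nsyX (x y : Σ i : ZMod n, Fin (m i)) {i : ZMod n} {j r s : ℕ} (hr : r < m i)
    (hs : s < m (i + j)) :
    entry k ℓ m x y (nsyX k ℓ m i j r s) =
      if x = ⟨i, r, hr⟩ ∧ y = ⟨i + j, s, hs⟩ then path k ℓ i j else 0 := by
  rw [entry_apply, nsyX, dif_pos ⟨hr, hs⟩, AlgEquiv.apply_symm_apply]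
  simp only [LinearMap.comp_apply, LinearMap.proj_apply, LinearMap.single_apply]
  by_cases hx : x = ⟨i, r, hr⟩
  · subst hx
    rw [Pi.single_eq_same]
    by_cases hy : y = ⟨i + j, s, hs⟩
    · subst hy
      rw [Pi.single_eq_same, if_pos ⟨rfl, rfl⟩]
      exact (path_mul_e k ℓ i _ j).trans (if_pos rfl)
    · rw [Pi.single_eq_of_ne (Ne.symm hy), map_zero, if_neg (fun h => hy h.2)]
      rfl
  · rw [Pi.single_eq_of_ne hx, if_neg (fun h => hx h.1)]
    rfl

/-! ### Multiplication table of the elements X_{i,j}^{r,s}. -/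

theorem nsyX_of_not {i : ZMod n} {j r s : ℕ} (h : ¬(r < m i ∧ s < m (i + j))) :
    nsyX k ℓ m i j r s = 0 :=
  dif_neg h

theorem nsyX_eq_zero {i : ZMod n} {j : ℕ} (r s : ℕ) (hj : ℓ ≤ j) : nsyX k ℓ m i j r s = 0 := by
  by_cases h : r < m i ∧ s < m (i + j)
  · refine ext_entry k ℓ m fun x y => ?_
    rw [entry_nsyX k ℓ m x y h.1 h.2, path_eq_zero k ℓ hj]
    simp
  · exact nsyX_of_not k ℓ m h

theorem nsyX_mul_nsyX_of_ne {i h : ZMod n} {j q r s r' s' : ℕ} (hne : ¬(h = i + j ∧ r' = s)) :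
    nsyX k ℓ m i j r s * nsyX k ℓ m h q r' s' = 0 := by
  by_cases h₁ : r < m i ∧ s < m (i + j)
  · by_cases h₂ : r' < m h ∧ s' < m (h + q)
    · refine ext_entry k ℓ m fun x y => ?_
      rw [entry_mul, map_zero]
      refine Finset.sum_eq_zero fun z _ => ?_
      rw [entry_nsyX k ℓ m x z h₁.1 h₁.2, entry_nsyX k ℓ m z y h₂.1 h₂.2]
      split_ifs with hxz hzy
      · exfalso
        have h₃ := hxz.2.symm.trans hzy.1
        apply hne
        simp only [Sigma.mk.injEq] at h₃
        obtain ⟨rfl, h₄⟩ := h₃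
        exact ⟨rfl, by simpa using h₄.symm⟩
      all_goals simp
    · rw [nsyX_of_not k ℓ m h₂, mul_zero]
  · rw [nsyX_of_not k ℓ m h₁, zero_mul]

/-- For r or s' out of range both sides take the default value 0. The bound on s is needed: without
it the left side is 0 while the right need not be. -/
theorem nsyX_mul_nsyX {i h : ZMod n} {j q r s s' : ℕ} (hh : h = i + j) (hs : s < m h) :
    nsyX k ℓ m i j r s * nsyX k ℓ m h q s s' = nsyX k ℓ m i (j + q) r s' := by
  subst hh
  by_cases hr : r < m i
  · have hm : m (i + j + q) = m (i + (j + q : ℕ)) := by rw [Nat.cast_add, add_assoc]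
    by_cases hs' : s' < m (i + j + q)
    · refine ext_entry k ℓ m fun x y => ?_
      rw [entry_mul, Finset.sum_eq_single ⟨i + j, s, hs⟩ _ (by simp),
        entry_nsyX k ℓ m _ _ hr hs, entry_nsyX k ℓ m _ _ hs hs', entry_nsyX k ℓ m _ _ hr (hm ▸ hs')]
      -- The two expressions for the end vertex are only propositionally equal, so the `Fin`
      -- components have different types.
      · have hy : (⟨i + j + q, s', hs'⟩ : Σ i : ZMod n, Fin (m i)) =
            ⟨i + (j + q : ℕ), s', hm ▸ hs'⟩ := by
          have : i + j + q = i + (j + q : ℕ) := by rw [Nat.cast_add, add_assoc]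
          congr! 1
          exact (Fin.heq_ext_iff hm).2 rfl
        rw [hy]
        by_cases h₁ : x = ⟨i, r, hr⟩
        · by_cases h₂ : y = ⟨i + (j + q : ℕ), s', hm ▸ hs'⟩
          · rw [if_pos ⟨h₁, rfl⟩, if_pos ⟨rfl, h₂⟩, if_pos ⟨h₁, h₂⟩, path_mul_path, if_pos rfl]
          · simp [h₂]
        · simp [h₁]
      · intro z _ hz
        rw [entry_nsyX k ℓ m _ _ hr hs, if_neg (fun h => hz h.2), zero_mul]
    · rw [nsyX_of_not k ℓ m (i := i + j) (fun h => hs' h.2),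
        nsyX_of_not k ℓ m (j := j + q) (fun h => hs' (hm ▸ h.2)), mul_zero]
  · rw [nsyX_of_not k ℓ m (j := j) (fun h => hr h.1),
      nsyX_of_not k ℓ m (j := j + q) (fun h => hr h.1), zero_mul]

/-! ## The basis -/

/-- The coordinate at `X_{i,j}^{r,s}`. -/
def coord (x : NSYIndex ℓ m) : NSYAlgebra k ℓ m →ₗ[k] k :=
  coeff k ℓ x.1.1 ⟨x.1.2.1, x.2.1⟩ ∘ₗ
    entry k ℓ m ⟨x.1.1, x.1.2.2.1, x.2.2.1⟩ ⟨x.1.1 + (x.1.2.1 : ℕ), x.1.2.2.2, x.2.2.2⟩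

/-- The family `X_{i,j}^{r,s}` over the admissible indices. -/
abbrev basisX (x : NSYIndex ℓ m) : NSYAlgebra k ℓ m :=
  nsyX k ℓ m x.1.1 x.1.2.1 x.1.2.2.1 x.1.2.2.2

theorem coord_basisX (x y : NSYIndex ℓ m) :
    coord k ℓ m x (basisX k ℓ m y) = if x = y then 1 else 0 := by
  rw [coord, LinearMap.comp_apply, basisX, entry_nsyX k ℓ m _ _ y.2.2.1 y.2.2.2]
  split_ifs with h₁ h₂ h₂
  · subst h₂
    simp [coeff_path]
  · rw [coeff_path, if_neg]
    rintro ⟨h₃, h₄⟩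
    apply h₂
    obtain ⟨⟨i, j, r, s⟩, hx⟩ := x
    obtain ⟨⟨i', j', r', s'⟩, hy⟩ := y
    simp only at h₃ h₄
    subst h₃ h₄
    simpa using h₁
  · subst h₂
    simp at h₁
  · exact map_zero _

theorem linearIndependent_basisX : LinearIndependent k (basisX k ℓ m) := by
  refine LinearIndependent.of_pairwise_dual_eq_zero_one _ (coord k ℓ m) ?_ ?_
  · intro x y hxy
    rw [coord_basisX, if_neg hxy]
  · intro x
    rw [coord_basisX, if_pos rfl]

/-- Each entry expands in the paths joining its two vertices, and such a path placed at a single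
entry is one of the X. -/
theorem eq_sum_coeff_nsyX (f : NSYAlgebra k ℓ m) :
    f = ∑ x : Σ i : ZMod n, Fin (m i), ∑ y : Σ i : ZMod n, Fin (m i), ∑ j : Fin ℓ,
      if y.1 = x.1 + (j : ℕ) then
        coeff k ℓ x.1 j (entry k ℓ m x y f) • nsyX k ℓ m x.1 j x.2 y.2 else 0 := by
  have key (x y x' y' : Σ i : ZMod n, Fin (m i)) (j : Fin ℓ) :
      entry k ℓ m x y (if y'.1 = x'.1 + (j : ℕ) then
        coeff k ℓ x'.1 j (entry k ℓ m x' y' f) • nsyX k ℓ m x'.1 j x'.2 y'.2 else 0) =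
      if x = x' ∧ y = y' then (if y'.1 = x'.1 + (j : ℕ) then
        coeff k ℓ x'.1 j (entry k ℓ m x' y' f) • path k ℓ x'.1 j else 0) else 0 := by
    by_cases h : y'.1 = x'.1 + (j : ℕ)
    · obtain ⟨h', s⟩ := y'
      obtain ⟨i, r⟩ := x'
      simp only at h
      subst h
      rw [if_pos rfl, if_pos rfl, map_smul, entry_nsyX k ℓ m _ _ r.2 s.2]
      split_ifs <;> simp
    · rw [if_neg h, if_neg h, map_zero]
      simp
  refine ext_entry k ℓ m fun x y => ?_
  conv_lhs => rw [eq_sum_coeff_of_mul k ℓ (e_mul_entry k ℓ m f x y) (entry_mul_e k ℓ m f x y)]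
  simp only [map_sum, key]
  rw [Finset.sum_eq_single x _ (by simp), Finset.sum_eq_single y _ (by simp)]
  · simp
  · intro y' _ hy
    simp [hy.symm]
  · intro x' _ hx
    simp [hx.symm]

theorem span_basisX : Submodule.span k (Set.range (basisX k ℓ m)) = ⊤ := by
  rw [eq_top_iff]
  intro f _
  rw [eq_sum_coeff_nsyX k ℓ m f]
  refine sum_mem fun x _ => sum_mem fun y _ => sum_mem fun j _ => ?_
  split_ifs with h
  · obtain ⟨h', s⟩ := y
    simp only at h
    subst h
    exact Submodule.smul_mem _ _ (Submodule.subset_span ⟨⟨(x.1, j, x.2, s), j.2, x.2.2, s.2⟩, rfl⟩)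
  · exact zero_mem _

/-- The basis `X_{i,j}^{r,s}`. -/
def basis : Module.Basis (NSYIndex ℓ m) k (NSYAlgebra k ℓ m) :=
  Module.Basis.mk (linearIndependent_basisX k ℓ m) (span_basisX k ℓ m).ge

theorem basis_apply (x : NSYIndex ℓ m) : basis k ℓ m x = basisX k ℓ m x :=
  Module.Basis.mk_apply _ _ x

theorem hom_ext_nsyX {M : Type*} [AddCommGroup M] [Module k M] {φ ψ : NSYAlgebra k ℓ m →ₗ[k] M}
    (h : ∀ (i : ZMod n) (j r s : ℕ), j < ℓ → r < m i → s < m (i + j) →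
      φ (nsyX k ℓ m i j r s) = ψ (nsyX k ℓ m i j r s)) : φ = ψ := by
  refine (basis k ℓ m).ext fun x => ?_
  rw [basis_apply]
  exact h _ _ _ _ x.2.1 x.2.2.1 x.2.2.2

theorem one_eq_sum : (1 : NSYAlgebra k ℓ m) =
    ∑ i, ∑ r ∈ Finset.range (m i), nsyX k ℓ m i 0 r r := by
  -- Left multiplication by the sum fixes every basis element; evaluating at 1 then gives the claim.
  have h : LinearMap.id = LinearMap.mulLeft k
      (∑ i, ∑ r ∈ Finset.range (m i), nsyX k ℓ m i 0 r r) := by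
    refine hom_ext_nsyX k ℓ m fun i j r s hj hr hs => ?_
    rw [LinearMap.mulLeft_apply, Finset.sum_mul, Finset.sum_eq_single i _ (by simp),
      Finset.sum_mul, Finset.sum_eq_single r]
    · rw [nsyX_mul_nsyX k ℓ m (by simp) hr, Nat.zero_add]
      rfl
    · intro r' _ hr'
      exact nsyX_mul_nsyX_of_ne k ℓ m (fun h => hr' h.2.symm)
    · intro h
      simp [hr] at h
    · intro i' _ hi
      rw [Finset.sum_mul]
      refine Finset.sum_eq_zero fun r' _ => nsyX_mul_nsyX_of_ne k ℓ m (fun h => hi ?_)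
      simpa using h.1.symm
  simpa using LinearMap.congr_fun h 1

end NSYAlgebra

/-! ## The Casimir element and the comultiplication -/

namespace NSYAlgebra

variable (k : Type*) [Field k] {n : ℕ} (ℓ : ℕ) (m : ZMod n → ℕ)

/-- The coefficient `1 - δ_{m_a, m_{a-ℓ+1}} (1 - δ_{t,u})`. -/
def weight (a : ZMod n) (t u : ℕ) : k :=
  1 - (if m a = m (a - ℓ + 1) then (1 : k) else 0) * (1 - (if t = u then (1 : k) else 0))

variable {m} in
theorem weight_of_eq (h : ∀ i, m i = m (i - ℓ + 1)) (a : ZMod n) (t u : ℕ) :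
    weight k ℓ m a t u = if t = u then 1 else 0 := by
  rw [weight, if_pos (h a)]
  ring

variable [NeZero n]

/-- The value at `1` of the comultiplication. -/
def casimir : NSYAlgebra k ℓ m ⊗[k] NSYAlgebra k ℓ m :=
  ∑ i, ∑ r ∈ Finset.range (m i), ∑ p ∈ Finset.range ℓ, ∑ t ∈ Finset.range (m (i + p)),
    ∑ u ∈ Finset.range (m (i + p - ℓ + 1)), weight k ℓ m (i + p) t u •
      (nsyX k ℓ m i p r t ⊗ₜ[k] nsyX k ℓ m (i + p - ℓ + 1) (ℓ - 1 - p) u r)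

/-- In each Casimir term the second path ends at the vertex a where the first begins. -/
theorem add_sub_add_cast {n : ℕ} (a : ZMod n) {ℓ p : ℕ} (hp : p < ℓ) :
    a + p - ℓ + 1 + (ℓ - 1 - p : ℕ) = a := by
  have h : ((ℓ - 1 - p : ℕ) : ZMod n) + p + 1 = ℓ := by
    have : ℓ - 1 - p + p + 1 = ℓ := by omega
    exact_mod_cast congrArg (Nat.cast : ℕ → ZMod n) this
  rw [← h]
  ring

/-- Only the terms whose first factor starts at (i+j, s) survive, and among them those with j + p <
ℓ. The weight is never unfolded: any scalars depending on the end vertex of the first path, t and u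
would do. -/
theorem leftActionOn_casimir {i : ZMod n} {j r s : ℕ} (hs : s < m (i + j)) :
    leftActionOn (casimir k ℓ m) (nsyX k ℓ m i j r s) =
      ∑ p ∈ Finset.range (ℓ - j), ∑ t ∈ Finset.range (m (i + j + p)),
        ∑ u ∈ Finset.range (m (i + j + p - ℓ + 1)), weight k ℓ m (i + j + p) t u •
          (nsyX k ℓ m i (j + p) r t ⊗ₜ[k] nsyX k ℓ m (i + j + p - ℓ + 1) (ℓ - 1 - p) u s) := by
  simp only [leftActionOn_apply, casimir, map_sum, map_smul, LinearMap.rTensor_tmul,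
    LinearMap.mulLeft_apply]
  rw [Finset.sum_eq_single (i + (j : ZMod n)) _ (by simp), Finset.sum_eq_single s]
  · simp only [nsyX_mul_nsyX k ℓ m rfl hs]
    refine (Finset.sum_subset (Finset.range_mono (Nat.sub_le ℓ j)) fun p _ hp => ?_).symm
    have hp : ℓ ≤ j + p := by
      rw [Finset.mem_range] at hp
      omega
    simp [nsyX_eq_zero k ℓ m _ _ hp]
  · intro r' _ hr'
    simp [nsyX_mul_nsyX_of_ne k ℓ m (i := i) (j := j) (fun h => hr' h.2)]
  · intro h
    simp [hs] at h
  · intro h _ hne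
    simp [nsyX_mul_nsyX_of_ne k ℓ m (i := i) (j := j) (fun h => hne h.1)]

theorem rightActionOn_casimir {i : ZMod n} {j r s : ℕ} (hj : j < ℓ) (hr : r < m i) :
    rightActionOn (casimir k ℓ m) (nsyX k ℓ m i j r s) =
      ∑ p ∈ Finset.range (ℓ - j), ∑ t ∈ Finset.range (m (i + j + p)),
        ∑ u ∈ Finset.range (m (i + j + p - ℓ + 1)), weight k ℓ m (i + j + p) t u •
          (nsyX k ℓ m i (j + p) r t ⊗ₜ[k] nsyX k ℓ m (i + j + p - ℓ + 1) (ℓ - 1 - p) u s) := by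
  have hne (i' : ZMod n) (r' p u : ℕ) (hp : p ∈ Finset.range ℓ) (h : ¬(i' = i ∧ r' = r)) :
      nsyX k ℓ m (i' + p - ℓ + 1) (ℓ - 1 - p) u r' * nsyX k ℓ m i j r s = 0 := by
    refine nsyX_mul_nsyX_of_ne k ℓ m fun h' => h ⟨?_, h'.2.symm⟩
    rw [h'.1, add_sub_add_cast i' (Finset.mem_range.1 hp)]
  simp only [rightActionOn_apply, casimir, map_sum, map_smul, LinearMap.lTensor_tmul,
    LinearMap.mulRight_apply]
  rw [Finset.sum_eq_single i _ (by simp), Finset.sum_eq_single r]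
  -- The second factor now has length ℓ-1-p+j, hence vanishes for p < j; shifting p by j matches the
  -- left action.
  · have hsplit (f : ℕ → NSYAlgebra k ℓ m ⊗[k] NSYAlgebra k ℓ m) : ∑ p ∈ Finset.range ℓ, f p =
        ∑ p ∈ Finset.range j, f p + ∑ p ∈ Finset.range (ℓ - j), f (j + p) := by
      rw [← Finset.sum_range_add, Nat.add_sub_cancel' hj.le]
    rw [hsplit, Finset.sum_eq_zero, zero_add]
    · refine Finset.sum_congr rfl fun p hp => ?_
      have hp' : j + p < ℓ := by
        rw [Finset.mem_range] at hp
        omega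
      rw [Nat.cast_add j p, ← add_assoc]
      refine Finset.sum_congr rfl fun t _ => Finset.sum_congr rfl fun u _ => ?_
      have h := add_sub_add_cast i hp'
      rw [Nat.cast_add j p, ← add_assoc] at h
      rw [nsyX_mul_nsyX k ℓ m h.symm hr]
      congr 3
      omega
    · intro p hp
      rw [Finset.mem_range] at hp
      refine Finset.sum_eq_zero fun t _ => Finset.sum_eq_zero fun u _ => ?_
      rw [nsyX_mul_nsyX k ℓ m (add_sub_add_cast i (by omega)).symm hr,
        nsyX_eq_zero k ℓ m u s (by omega), TensorProduct.tmul_zero, smul_zero]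
  · intro r' _ hr'
    refine Finset.sum_eq_zero fun p hp => Finset.sum_eq_zero fun t _ => Finset.sum_eq_zero fun u _ => ?_
    rw [hne _ _ _ _ hp (fun h => hr' h.2), TensorProduct.tmul_zero, smul_zero]
  · intro h
    simp [hr] at h
  · intro i' _ hi
    refine Finset.sum_eq_zero fun r' _ => Finset.sum_eq_zero fun p hp =>
      Finset.sum_eq_zero fun t _ => Finset.sum_eq_zero fun u _ => ?_
    rw [hne _ _ _ _ hp (fun h => hi h.1), TensorProduct.tmul_zero, smul_zero]

theorem leftActionOn_casimir_eq :
    leftActionOn (casimir k ℓ m) = rightActionOn (casimir k ℓ m) := by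
  refine hom_ext_nsyX k ℓ m fun i j r s hj hr hs => ?_
  rw [leftActionOn_casimir k ℓ m hs, rightActionOn_casimir k ℓ m hj hr]

/-! ## The counit -/

/-- The linear form `X_{i,j}^{r,s} ↦ δ_{j,ℓ-1} δ_{r,s}`. -/
def counit : NSYAlgebra k ℓ m →ₗ[k] k :=
  (basis k ℓ m).constr k fun x =>
    (if x.1.2.1 = ℓ - 1 then 1 else 0) * (if x.1.2.2.1 = x.1.2.2.2 then 1 else 0)

theorem counit_nsyX {i : ZMod n} {j r s : ℕ} (hj : j < ℓ) (hr : r < m i) (hs : s < m (i + j)) :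
    counit k ℓ m (nsyX k ℓ m i j r s) =
      (if j = ℓ - 1 then 1 else 0) * (if r = s then 1 else 0) := by
  have h := (basis k ℓ m).constr_basis k (fun x =>
    (if x.1.2.1 = ℓ - 1 then (1 : k) else 0) * (if x.1.2.2.1 = x.1.2.2.2 then 1 else 0))
    ⟨(i, j, r, s), hj, hr, hs⟩
  rwa [basis_apply] at h

variable {m}

/-- The counit forces p = ℓ-1 and t = r, the weight forces u = t, and the remaining second factors
X_{i,0}^{r,r} sum to 1. -/
theorem lid_counit_casimir (hℓ : 1 ≤ ℓ) (h : ∀ i, m i = m (i - ℓ + 1)) :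
    TensorProduct.lid k _ ((counit k ℓ m).rTensor _ (casimir k ℓ m)) = 1 := by
  simp only [casimir, map_sum, map_smul, LinearMap.rTensor_tmul, TensorProduct.lid_tmul]
  rw [one_eq_sum]
  refine Finset.sum_congr rfl fun i _ => Finset.sum_congr rfl fun r hr => ?_
  rw [Finset.mem_range] at hr
  have hcast : i + (ℓ - 1 : ℕ) - ℓ + 1 = i := by
    have := add_sub_add_cast i (p := ℓ - 1) (ℓ := ℓ) (by omega)
    rwa [Nat.sub_self, Nat.cast_zero, add_zero] at this
  have hmi : m (i + (ℓ - 1 : ℕ)) = m i := by rw [h (i + (ℓ - 1 : ℕ)), hcast]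
  rw [Finset.sum_eq_single (ℓ - 1), Finset.sum_eq_single r, Finset.sum_eq_single r]
  · rw [weight_of_eq k ℓ h, counit_nsyX k ℓ m (by omega) hr (hmi ▸ hr), hcast]
    simp
  · intro u _ hu
    rw [weight_of_eq k ℓ h, if_neg hu.symm, zero_smul]
  · intro h'
    rw [hcast, Finset.mem_range] at h'
    exact absurd hr h'
  · intro t ht hne
    refine Finset.sum_eq_zero fun u _ => ?_
    rw [counit_nsyX k ℓ m (by omega) hr (Finset.mem_range.1 ht), if_neg hne.symm, mul_zero,
      zero_smul, smul_zero]
  · intro h'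
    rw [hmi, Finset.mem_range] at h'
    exact absurd hr h'
  · intro p hp hne
    refine Finset.sum_eq_zero fun t ht => Finset.sum_eq_zero fun u _ => ?_
    rw [counit_nsyX k ℓ m (Finset.mem_range.1 hp) hr (Finset.mem_range.1 ht), if_neg hne, zero_mul,
      zero_smul, smul_zero]
  · intro h'
    rw [Finset.mem_range] at h'
    omega

/-- Mirror image: the second factor has length ℓ-1 exactly when p = 0, and u = r together with the
weight gives t = r. -/
theorem rid_counit_casimir (hℓ : 1 ≤ ℓ) (h : ∀ i, m i = m (i - ℓ + 1)) :
    TensorProduct.rid k _ ((counit k ℓ m).lTensor _ (casimir k ℓ m)) = 1 := by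
  simp only [casimir, map_sum, map_smul, LinearMap.lTensor_tmul, TensorProduct.rid_tmul]
  rw [one_eq_sum]
  refine Finset.sum_congr rfl fun i _ => Finset.sum_congr rfl fun r hr => ?_
  have key (p t u : ℕ) (hp : p ∈ Finset.range ℓ)
      (hu : u ∈ Finset.range (m (i + p - ℓ + 1))) :
      counit k ℓ m (nsyX k ℓ m (i + p - ℓ + 1) (ℓ - 1 - p) u r) =
        (if p = 0 then 1 else 0) * (if u = r then 1 else 0) := by
    rw [Finset.mem_range] at hp hr hu
    rw [counit_nsyX k ℓ m (by omega) hu (by rwa [add_sub_add_cast i hp])]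
    congr 2
    exact propext ⟨fun _ => by omega, fun _ => by omega⟩
  have hmi : m (i + (0 : ℕ) - ℓ + 1) = m i := by rw [Nat.cast_zero, add_zero, ← h]
  rw [Finset.sum_eq_single 0, Finset.sum_eq_single r, Finset.sum_eq_single r]
  · rw [weight_of_eq k ℓ h, key 0 r r (Finset.mem_range.2 hℓ) (by rwa [hmi])]
    simp
  · intro u _ hu
    rw [weight_of_eq k ℓ h, if_neg hu.symm, zero_smul]
  · intro h'
    rw [hmi] at h'
    exact absurd hr h'
  · intro t ht hne
    refine Finset.sum_eq_zero fun u hu => ?_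
    rw [key 0 t u (Finset.mem_range.2 hℓ) hu, weight_of_eq k ℓ h]
    rcases eq_or_ne t u with rfl | htu
    · rw [if_neg hne, mul_zero, zero_smul, smul_zero]
    · rw [if_neg htu, zero_smul]
  · intro h'
    rw [Nat.cast_zero, add_zero] at h'
    exact absurd hr h'
  · intro p hp hne
    refine Finset.sum_eq_zero fun t ht => Finset.sum_eq_zero fun u hu => ?_
    rw [key p t u hp hu, if_neg hne, zero_mul, zero_smul, smul_zero]
  · intro h'
    rw [Finset.mem_range] at h'
    omega

theorem isCounitOf_counit (hℓ : 1 ≤ ℓ) (h : ∀ i, m i = m (i - ℓ + 1)) :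
    IsCounitOf (leftActionOn (casimir k ℓ m)) (counit k ℓ m) where
  left := counit_left_leftActionOn _ (leftActionOn_casimir_eq k ℓ m) _ (lid_counit_casimir k ℓ hℓ h)
  right := counit_right_leftActionOn _ _ (rid_counit_casimir k ℓ hℓ h)

/-! ## The multiplicities of a Frobenius algebra -/

variable (m) in
/-- The part of the socle of the algebra in the row `(i, 0)`. -/
def socleRow (i : ZMod n) : (Fin (m (i + (ℓ - 1 : ℕ))) → k) →ₗ[k] NSYAlgebra k ℓ m :=
  Fintype.linearCombination k fun s => nsyX k ℓ m i (ℓ - 1) 0 s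

theorem socleRow_apply (i : ZMod n) (c : Fin (m (i + (ℓ - 1 : ℕ))) → k) :
    socleRow k ℓ m i c = ∑ s, c s • nsyX k ℓ m i (ℓ - 1) 0 s := rfl

theorem socleRow_injective (hℓ : 1 ≤ ℓ) (i : ZMod n) (hi : 0 < m i) :
    Function.Injective (socleRow k ℓ m i) := by
  have hli : LinearIndependent k fun s : Fin (m (i + (ℓ - 1 : ℕ))) => nsyX k ℓ m i (ℓ - 1) 0 s :=
    (linearIndependent_basisX k ℓ m).comp
      (fun s : Fin (m (i + (ℓ - 1 : ℕ))) => ⟨(i, ℓ - 1, 0, s), Nat.sub_lt hℓ one_pos, hi, s.2⟩)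
      (fun s t hst => by simpa [Fin.ext_iff] using hst)
  exact linearIndependent_iff_injective_fintypeLinearCombination.1 hli

/-- Compares dimensions through the pairing by ε. Positivity of m_i guarantees that row 0 at i
exists. -/
theorem multiplicity_le (hℓ : 1 ≤ ℓ) (hm : ∀ i, 0 < m i)
    (hF : IsFrobeniusAlgebra k (NSYAlgebra k ℓ m)) (i : ZMod n) :
    m (i + (ℓ - 1 : ℕ)) ≤ m i := by
  obtain ⟨Δ, ε, hΔ, hε⟩ := hF
  -- Pairs a socle element with the X_{i,0}^{r,0}, the only basis elements that do not kill it from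
  -- the left.
  let φ : (Fin (m (i + (ℓ - 1 : ℕ))) → k) →ₗ[k] (Fin (m i) → k) :=
    LinearMap.pi fun r => ε ∘ₗ LinearMap.mulLeft k (nsyX k ℓ m i 0 r 0) ∘ₗ socleRow k ℓ m i
  have hφ : Function.Injective φ := by
    rw [← LinearMap.ker_eq_bot, LinearMap.ker_eq_bot']
    intro c hc
    have hc (r : ℕ) (hr : r < m i) : ε (nsyX k ℓ m i 0 r 0 * socleRow k ℓ m i c) = 0 :=
      congrFun hc ⟨r, hr⟩
    refine socleRow_injective k ℓ hℓ i (hm i) ?_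
    rw [map_zero]
    refine hΔ.eq_zero_of_forall_counit_mul hε fun y => ?_
    suffices h : ε ∘ₗ LinearMap.mulRight k (socleRow k ℓ m i c) = 0 from LinearMap.congr_fun h y
    refine hom_ext_nsyX k ℓ m fun h q r s hq hr hs => ?_
    rw [LinearMap.comp_apply, LinearMap.mulRight_apply, LinearMap.zero_apply]
    by_cases hi : i = h + q ∧ 0 = s
    · obtain ⟨hi, rfl⟩ := hi
      rcases Nat.eq_zero_or_pos q with rfl | hq'
      · rw [Nat.cast_zero, add_zero] at hi
        subst hi
        exact hc r hr
      -- For q > 0 the product has length q + ℓ - 1 ≥ ℓ.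
      · rw [socleRow_apply, Finset.mul_sum, Finset.sum_eq_zero, map_zero]
        intro t _
        rw [mul_smul_comm, nsyX_mul_nsyX k ℓ m hi (hm i), nsyX_eq_zero k ℓ m _ _ (by omega),
          smul_zero]
    · rw [socleRow_apply, Finset.mul_sum, Finset.sum_eq_zero, map_zero]
      intro t _
      rw [mul_smul_comm, nsyX_mul_nsyX_of_ne k ℓ m hi, smul_zero]
  simpa using LinearMap.finrank_le_finrank_of_injective hφ

/-- Rotating the cycle preserves the total of the m_i, so no inequality in `multiplicity_le` can be
strict. -/
theorem multiplicity_eq (hℓ : 1 ≤ ℓ) (hm : ∀ i, 0 < m i)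
    (hF : IsFrobeniusAlgebra k (NSYAlgebra k ℓ m)) (i : ZMod n) : m i = m (i - ℓ + 1) := by
  have hsum : ∑ i, m (i + (ℓ - 1 : ℕ)) = ∑ i, m i :=
    Equiv.sum_comp (Equiv.addRight ((ℓ - 1 : ℕ) : ZMod n)) m
  have h := (Finset.sum_eq_sum_iff_of_le fun i _ => multiplicity_le k ℓ hℓ hm hF i).1 hsum
    (i - ℓ + 1) (Finset.mem_univ _)
  have hi := add_sub_add_cast i (p := 0) (ℓ := ℓ) (by omega)
  rw [Nat.cast_zero, add_zero, Nat.sub_zero] at hi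
  rwa [hi] at h

end NSYAlgebra

end

/-! ### The main theorem. -/

theorem theorem2p7 (k : Type*) [Field k] (n ℓ : ℕ) [NeZero n] (hℓ : 1 ≤ ℓ)
    (m : ZMod n → ℕ) (hm : ∀ i, 0 < m i) :
    -- the elements `X_{i,j}^{r,s}` form a basis
    (LinearIndependent k (fun x : NSYIndex ℓ m =>
        nsyX k ℓ m x.1.1 x.1.2.1 x.1.2.2.1 x.1.2.2.2) ∧
      Submodule.span k (Set.range (fun x : NSYIndex ℓ m =>
        nsyX k ℓ m x.1.1 x.1.2.1 x.1.2.2.1 x.1.2.2.2)) = ⊤) ∧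
    ∃ Δ : NSYAlgebra k ℓ m →ₗ[k] NSYAlgebra k ℓ m ⊗[k] NSYAlgebra k ℓ m,
      -- the formula for the comultiplication
      (∀ (i : ZMod n) (j r s : ℕ), j < ℓ → r < m i → s < m (i + j) →
        Δ (nsyX k ℓ m i j r s) =
          ∑ p ∈ Finset.range (ℓ - j), ∑ t ∈ Finset.range (m (i + j + p)),
            ∑ u ∈ Finset.range (m (i + j + p - ℓ + 1)),
              (1 - (if m (i + j + p) = m (i + j + p - ℓ + 1) then (1 : k) else 0) *
                  (1 - (if t = u then (1 : k) else 0))) •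
                (nsyX k ℓ m i (j + p) r t ⊗ₜ[k]
                  nsyX k ℓ m (i + j + p - ℓ + 1) (ℓ - 1 - p) u s)) ∧
      IsNonCounitalFrobenius Δ ∧
      -- when the algebra is Frobenius, and when this comultiplication makes it so
      (IsFrobeniusAlgebra k (NSYAlgebra k ℓ m) ↔ ∀ i, m i = m (i - ℓ + 1)) ∧
      ((∃ ε : NSYAlgebra k ℓ m →ₗ[k] k, IsCounitOf Δ ε) ↔ ∀ i, m i = m (i - ℓ + 1)) ∧
      -- the formula for the counit
      ((∀ i, m i = m (i - ℓ + 1)) →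
        ∃ ε : NSYAlgebra k ℓ m →ₗ[k] k,
          (∀ (i : ZMod n) (j r s : ℕ), j < ℓ → r < m i → s < m (i + j) →
            ε (nsyX k ℓ m i j r s) =
              (if j = ℓ - 1 then 1 else 0) * (if r = s then 1 else 0)) ∧
          IsCounitOf Δ ε) := by
  have hF := isNonCounitalFrobenius_leftActionOn _ (NSYAlgebra.leftActionOn_casimir_eq k ℓ m)
  have hC := NSYAlgebra.isCounitOf_counit (m := m) k ℓ hℓ
  refine ⟨⟨NSYAlgebra.linearIndependent_basisX k ℓ m, NSYAlgebra.span_basisX k ℓ m⟩,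
    leftActionOn (NSYAlgebra.casimir k ℓ m), ?_, hF, ⟨?_, ?_⟩, ⟨?_, ?_⟩, ?_⟩
  · exact fun i j r s _ _ hs => NSYAlgebra.leftActionOn_casimir k ℓ m hs
  · exact NSYAlgebra.multiplicity_eq k ℓ hℓ hm
  · exact fun h => ⟨_, _, hF, hC h⟩
  · rintro ⟨ε, hε⟩
    exact NSYAlgebra.multiplicity_eq k ℓ hℓ hm ⟨_, ε, hF, hε⟩
  · exact fun h => ⟨_, hC h⟩
  · exact fun h => ⟨_, fun _ _ _ _ hj hr hs => NSYAlgebra.counit_nsyX k ℓ m hj hr hs, hC h⟩
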